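/- **Conventions.** All matroids are on finite ground sets. A matroid $M$ is a *quotient* of a matroid $N$ on the same ground set if every independent set of $M$ is independent in $N$ and every flat of $M$ is a flat of $N$. *Points* and *lines* are the flats of rank one and two. A matroid is *taut* if it is not a quotient of any matroid of higher rank with the same points and lines. An *arrangement* $\mathcal A$ over a field $K$ is a finite set of linear subspaces of codimension one in $V=K^\ell$. Choose linear forms $\alpha_H\in V^*$ with $\ker\alpha_H=H$ for $H\in\mathcal A$. The underlying matroid of $\mathcal A$ is the matroid on $\mathcal A$ of linear dependencies of the family $(\alpha_H)_{H\in\mathcal A}$, and $\mathcal A$ is *formal* if the kernel of the linear map $\bigoplus_{H\in\mathcal A}K e_H\to V^*$, $e_H\mapsto\alpha_H$, is spanned by its elements with at most three nonzero entries. Neither notion depends on the choice of the forms. A *realization* of a simple matroid $M$ over $K$ is an arrangement in some $K^\ell$, labelled by the ground set of $M$, whose underlying matroid is $M$. **Theorem.** There is a simple matroid $M$ of rank $3$ on a ground set of $13$ elements such that 1. $M$ has a realization over $\mathbb Q$ by an arrangement in $\mathbb Q^3$; 2. $M$ is not taut; 3. for every field $K$ and every $\ell$, every realization of $M$ by an arrangement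 in $K^\ell$ is formal. -/

import Mathlib

open Set Module

namespace Matroid

variable {ι : Type*}

/-- A matroid is simple if it has no loops and no two distinct elements are parallel. -/
def IsSimple (M : Matroid ι) : Prop :=
  (∀ e ∈ M.E, ¬ M.IsLoop e) ∧ ∀ e ∈ M.E, ∀ f ∈ M.E, e ≠ f → M.Indep {e, f}

/-- `M` is a weak map image of `N`: both matroids have the same ground set, and every
independent set of `M` is independent in `N`. -/
def IsWeakMapImage (M N : Matroid ι) : Prop :=
  M.E = N.E ∧ ∀ I, M.Indep I → N.Indep I

/-- `M` is a quotient of `N`: it is a weak map image of `N`, and every flat of `M` is a flat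
of `N`. -/
def IsQuotientOf (M N : Matroid ι) : Prop :=
  M.IsWeakMapImage N ∧ ∀ F, M.IsFlat F → N.IsFlat F

/-- `F` is a flat of rank `k`; the points are the flats of rank one, the lines those of rank
two. -/
def IsFlatOfRank (M : Matroid ι) (k : ℕ) (F : Set ι) : Prop :=
  M.IsFlat F ∧ M.eRk F = k

def SamePointsAndLines (M N : Matroid ι) : Prop :=
  (∀ F, M.IsFlatOfRank 1 F ↔ N.IsFlatOfRank 1 F) ∧
    ∀ F, M.IsFlatOfRank 2 F ↔ N.IsFlatOfRank 2 F

/-- `M` is taut if it is not a quotient of any matroid of higher rank with the same points and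
lines. -/
def IsTaut (M : Matroid ι) : Prop :=
  ¬ ∃ N : Matroid ι, M.IsQuotientOf N ∧ M.SamePointsAndLines N ∧ M.eRank < N.eRank

end Matroid

section LinearMatroid

variable {ι K W : Type*} [Finite ι] [Field K] [AddCommGroup W] [Module K W]

theorem linearIndepOn_exists_insert (v : ι → W) {I J : Set ι} (hI : LinearIndepOn K v I)
    (hJ : LinearIndepOn K v J) (hlt : I.ncard < J.ncard) :
    ∃ e ∈ J, e ∉ I ∧ LinearIndepOn K v (insert e I) := by
  by_contra! hcon
  have hsub : v '' J ⊆ Submodule.span K (v '' I) := by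
    rintro _ ⟨e, he, rfl⟩
    by_cases heI : e ∈ I
    · exact Submodule.subset_span ⟨e, heI, rfl⟩
    · by_contra hn
      exact hcon e he heI (hI.insert hn)
  have card_eq : ∀ S : Set ι, LinearIndepOn K v S →
      finrank K (Submodule.span K (v '' S)) = S.ncard := by
    intro S hS
    have := Fintype.ofFinite S
    have h := finrank_span_eq_card (R := K) hS.linearIndependent
    rw [← Nat.card_eq_fintype_card, Nat.card_coe_set_eq] at h
    rwa [image_eq_range]
  have : FiniteDimensional K (Submodule.span K (v '' I)) :=
    FiniteDimensional.span_of_finite K (Set.toFinite _)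
  have := Submodule.finrank_mono (Submodule.span_le.2 hsub)
  rw [card_eq I hI, card_eq J hJ] at this
  omega

/-- The matroid of linear dependencies of a finite family of vectors: a set of indices is
independent if and only if the corresponding subfamily is linearly independent. -/
def linearMatroid (K : Type*) {W : Type*} [Field K] [AddCommGroup W] [Module K W]
    (v : ι → W) : Matroid ι :=
  (IndepMatroid.ofFinite (E := univ) Set.finite_univ (fun I => LinearIndepOn K v I)
    (linearIndepOn_empty K v)
    (fun _ _ hJ hIJ => hJ.mono hIJ)
    (fun _ _ hI hJ h => linearIndepOn_exists_insert v hI hJ h)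
    (fun _ _ => subset_univ _)).matroid

@[simp] theorem linearMatroid_indep (v : ι → W) (I : Set ι) :
    (linearMatroid K v).Indep I ↔ LinearIndepOn K v I := Iff.rfl

@[simp] theorem linearMatroid_ground (v : ι → W) : (linearMatroid K v).E = univ := rfl

end LinearMatroid

/-- A (central) arrangement in `K ^ ℓ`, its hyperplanes labelled bijectively by `ι`: pairwise
distinct linear subspaces of codimension one. -/
structure Arrangement (K : Type*) [Field K] (ℓ : ℕ) (ι : Type*) where
  hyperplane : ι → Submodule K (Fin ℓ → K)
  codim_eq_one : ∀ i, finrank K ((Fin ℓ → K) ⧸ hyperplane i) = 1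
  injective : Function.Injective hyperplane

namespace Arrangement

variable {K : Type*} [Field K] {ℓ : ℕ} {ι : Type*}

/-- The linear forms `α i` define the hyperplanes of the arrangement. -/
def IsDefinedBy (A : Arrangement K ℓ ι) (α : ι → Dual K (Fin ℓ → K)) : Prop :=
  ∀ i, LinearMap.ker (α i) = A.hyperplane i

theorem exists_isDefinedBy (A : Arrangement K ℓ ι) : ∃ α, A.IsDefinedBy α := by
  have h : ∀ i, ∃ a : Dual K (Fin ℓ → K), LinearMap.ker a = A.hyperplane i := by
    intro i
    have e : ((Fin ℓ → K) ⧸ A.hyperplane i) ≃ₗ[K] K :=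
      LinearEquiv.ofFinrankEq _ _ (by rw [A.codim_eq_one i, finrank_self])
    exact ⟨e.toLinearMap ∘ₗ (A.hyperplane i).mkQ, by
      rw [LinearEquiv.ker_comp, Submodule.ker_mkQ]⟩
  choose α hα using h
  exact ⟨α, hα⟩

/-- The underlying matroid of an arrangement: the linear matroid of its defining linear forms.
It does not depend on the choice of the forms, see `matroid_eq`. -/
noncomputable def matroid [Finite ι] (A : Arrangement K ℓ ι) : Matroid ι :=
  linearMatroid K A.exists_isDefinedBy.choose

theorem matroid_eq [Finite ι] (A : Arrangement K ℓ ι) {α : ι → Dual K (Fin ℓ → K)}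
    (hα : A.IsDefinedBy α) : A.matroid = linearMatroid K α := by
  have hβ := A.exists_isDefinedBy.choose_spec
  set β := A.exists_isDefinedBy.choose with hβdef
  have hunit : ∀ i, ∃ c : Kˣ, β i = c • α i := by
    intro i
    have hmem : β i ∈ Submodule.span K (range fun _ : Unit => α i) :=
      mem_span_of_iInf_ker_le_ker (by simp [hα i, hβ i])
    obtain ⟨c, hc⟩ := Submodule.mem_span_singleton.1 (by simpa using hmem)
    have hc0 : c ≠ 0 := by
      rintro rfl
      have h1 := A.codim_eq_one i
      have htop : A.hyperplane i = ⊤ := by rw [← hβ i, ← hc]; simp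
      rw [htop] at h1
      have := finrank_zero_of_subsingleton (R := K)
        (M := (Fin ℓ → K) ⧸ (⊤ : Submodule K (Fin ℓ → K)))
      omega
    exact ⟨Units.mk0 c hc0, hc.symm⟩
  choose c hc using hunit
  refine Matroid.ext_indep rfl fun I _ => ?_
  change LinearIndepOn K β I ↔ LinearIndepOn K α I
  have := LinearIndependent.units_smul_iff (R := K) (fun i : I => α i) (fun i => c i)
  rw [LinearIndepOn, LinearIndepOn, ← this]
  have hfun : (fun i : I => β i) = (fun i : I => c i) • fun i : I => α i := by
    funext i
    exact hc i
  rw [hfun]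

/-- An arrangement is formal if the kernel of the map `⨁ K e_i → V*`, `e_i ↦ α i`, is spanned
by its elements with at most three nonzero entries. The defining forms `α i` are unique up to
nonzero scalars, so this does not depend on their choice. -/
def IsFormal (A : Arrangement K ℓ ι) : Prop :=
  ∀ α : ι → Dual K (Fin ℓ → K), A.IsDefinedBy α →
    Submodule.span K {y : ι →₀ K | y ∈ LinearMap.ker (Finsupp.linearCombination K α) ∧
      y.support.card ≤ 3} = LinearMap.ker (Finsupp.linearCombination K α)

end Arrangement

/-! Points `0`–`7` satisfy five of the nine Pappus collinearities. By Pappus' theorem the lines `1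
6`, `2 3` and `7 4` could concur only if `3`, `5`, `7` were collinear, which they are not
(`eq_zero_of_pappus`). Points `8`–`12` carry this concurrence to rank four: if `8` and `9` were
lifted out of the plane of `0`–`7`, the line `8 9` would meet that plane in a point of all three
lines. An abstract matroid of rank four need not obey Pappus, so the lift exists combinatorially and
the matroid is not taut (`not_isTaut_of_planes`).

Linearly the lift is impossible. Formality reduces to showing that a family `f` obeying every
three-term relation of the forms lies in the span `U` of `f 0`, `f 1`, `f 2`. The lines among
`0`–`7` put `f 3`, …, `f 7` in `U`; the two lines through each of `10`, `11`, `12` give a relation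
between `f 8` and `f 9` modulo `U`. Either two of these are not proportional, and `f 8`, `f 9` lie
in `U`, or all three come from one nonzero vector on the lines `1 6`, `2 3`, `7 4`, against Pappus
(`mem_span_of_linear_relations`). -/

namespace Matroid

variable {ι : Type*} {M N : Matroid ι}

/-! ### Erections and tautness. -/

/-- The erection of a matroid `M` of rank at most three whose planes with at least four points are
the members of `planes`: its independent sets are those of `M`, together with the sets of four
elements in general position that no member of `planes` contains. -/
def erection [Finite ι] (M : Matroid ι) (planes : Set (Set ι))
    (rank_le : ∀ I, M.Indep I → I.ncard ≤ 3)
    (unique : ∀ B P P', M.Indep B → B.ncard = 3 → P ∈ planes → P' ∈ planes → B ⊆ P → B ⊆ P' →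
      P = P')
    (closed : ∀ B e, M.Indep B → B.ncard = 3 → e ∉ B →
      (∃ J ⊆ insert e B, J.ncard = 3 ∧ ¬ M.Indep J) → ∃ P ∈ planes, insert e B ⊆ P) :
    Matroid ι :=
  (IndepMatroid.ofFinite (E := univ) Set.finite_univ
    (fun I => M.Indep I ∨ I.ncard = 4 ∧ (∀ J ⊆ I, J.ncard = 3 → M.Indep J) ∧
      ∀ P ∈ planes, ¬ I ⊆ P)
    (Or.inl M.empty_indep)
    (by
      rintro I J (hJ | ⟨hJ, hJ3, hJP⟩) hIJ
      · exact Or.inl (hJ.subset hIJ)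
      have hle := Set.ncard_le_ncard hIJ (Set.toFinite J)
      rcases hle.lt_or_eq with hlt | heq
      · left
        obtain ⟨K, hIK, hKJ, hK⟩ := Set.exists_subsuperset_card_eq hIJ (n := 3) (by omega)
          (by omega)
        exact (hJ3 K hKJ hK).subset hIK
      · rw [Set.eq_of_subset_of_ncard_le hIJ heq.ge (Set.toFinite J)]
        exact Or.inr ⟨hJ, hJ3, hJP⟩)
    (by
      have aug : ∀ I J, M.Indep I → M.Indep J → I.ncard < J.ncard →
          ∃ e ∈ J, e ∉ I ∧ M.Indep (insert e I) := by
        intro I J hI hJ hlt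
        obtain ⟨e, he, h⟩ := hI.augment hJ (by
          rw [← (Set.toFinite I).cast_ncard_eq, ← (Set.toFinite J).cast_ncard_eq]
          exact_mod_cast hlt)
        exact ⟨e, he.1, he.2, h⟩
      rintro I J hI hJ hlt
      have hJ4 : J.ncard ≤ 4 := by
        rcases hJ with hJ | hJ
        · exact (rank_le J hJ).trans (by norm_num)
        · exact hJ.1.le
      replace hI : M.Indep I := hI.resolve_right fun h => by omega
      rcases hJ with hJ | ⟨hJ, hJ3, hJP⟩
      · obtain ⟨e, h1, h2, h3⟩ := aug I J hI hJ hlt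
        exact ⟨e, h1, h2, Or.inl h3⟩
      rcases (show I.ncard ≤ 3 by omega).lt_or_eq with hI3 | hI3
      · obtain ⟨K, -, hKJ, hK⟩ := Set.exists_subsuperset_card_eq (Set.empty_subset J) (n := 3)
          (by simp) (by omega)
        obtain ⟨e, h1, h2, h3⟩ := aug I K hI (hJ3 K hKJ hK) (by omega)
        exact ⟨e, hKJ h1, h2, Or.inl h3⟩
      -- If a plane `P` contains `I`, it is the only one, so any element of `J` off `P` will do.
      have key : ∃ e ∈ J, e ∉ I ∧ ∀ P ∈ planes, ¬ insert e I ⊆ P := by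
        by_cases hP : ∃ P ∈ planes, I ⊆ P
        · obtain ⟨P, hP, hIP⟩ := hP
          obtain ⟨e, heJ, heP⟩ := Set.not_subset.1 (hJP P hP)
          refine ⟨e, heJ, fun h => heP (hIP h), fun P' hP' h => heP ?_⟩
          rw [unique I P P' hI hI3 hP hP' hIP ((Set.subset_insert e I).trans h)]
          exact h (Set.mem_insert e I)
        · obtain ⟨e, heJ, heI⟩ := Set.exists_mem_notMem_of_ncard_lt_ncard hlt (Set.toFinite I)
          exact ⟨e, heJ, heI, fun P hP' h => hP ⟨P, hP', (Set.subset_insert e I).trans h⟩⟩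
      obtain ⟨e, heJ, heI, he⟩ := key
      refine ⟨e, heJ, heI, Or.inr ⟨by rw [Set.ncard_insert_of_notMem heI (Set.toFinite I), hI3],
        fun K hK hK3 => ?_, he⟩⟩
      by_contra hKn
      obtain ⟨P, hP, h⟩ := closed I e hI hI3 heI ⟨K, hK, hK3, hKn⟩
      exact he P hP h)
    (fun _ _ => subset_univ _)).matroid

/-- Membership of `e` in the closure of `I` only tests `insert e I`, of size at most `r`. -/
theorem closure_eq_of_indep_iff [Finite ι] {r : ℕ} (hE : M.E = N.E)
    (h : ∀ I : Set ι, I.ncard ≤ r → (M.Indep I ↔ N.Indep I)) {I : Set ι} (hI : M.Indep I)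
    (hIr : I.ncard < r) : M.closure I = N.closure I := by
  ext e
  rw [hI.mem_closure_iff', ((h I hIr.le).1 hI).mem_closure_iff', hE,
    h (insert e I) ((Set.ncard_insert_le e I).trans hIr)]

/-- A matroid of rank `r` is a quotient of every matroid with the same independent sets of size
at most `r`. -/
theorem isQuotientOf_of_indep_iff [Finite ι] {r : ℕ} (hE : M.E = N.E)
    (h : ∀ I : Set ι, I.ncard ≤ r → (M.Indep I ↔ N.Indep I))
    (hr : ∀ I, M.Indep I → I.ncard ≤ r) : M.IsQuotientOf N := by
  refine ⟨⟨hE, fun I hI => (h I (hr I hI)).1 hI⟩, fun F hF => ?_⟩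
  obtain ⟨I, hI⟩ := M.exists_isBasis F hF.subset_ground
  have hcl : M.closure I = F := by rw [hI.closure_eq_closure, hF.closure]
  rcases (hr I hI.indep).lt_or_eq with hlt | heq
  · rw [← hcl, closure_eq_of_indep_iff hE h hI.indep hlt]
    exact N.isFlat_closure I
  · have hmax : ∀ e ∈ M.E, e ∈ M.closure I := by
      intro e he
      rw [hI.indep.mem_closure_iff']
      refine ⟨he, fun hins => ?_⟩
      by_contra heI
      have := hr _ hins
      rw [Set.ncard_insert_of_notMem heI (Set.toFinite I)] at this
      omega
    have : F = N.E := by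
      rw [← hE]
      exact hF.subset_ground.antisymm fun e he => hcl ▸ hmax e he
    rw [this]
    exact N.ground_isFlat

theorem IsFlatOfRank.of_indep_iff [Finite ι] {r k : ℕ} (hE : M.E = N.E)
    (h : ∀ I : Set ι, I.ncard ≤ r → (M.Indep I ↔ N.Indep I)) (hk : k < r) {F : Set ι}
    (hF : M.IsFlatOfRank k F) : N.IsFlatOfRank k F := by
  obtain ⟨hF, hFk⟩ := hF
  obtain ⟨I, hI⟩ := M.exists_isBasis F hF.subset_ground
  have hIk : I.ncard = k := by
    have := hI.eRk_eq_encard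
    rw [hFk, ← (Set.toFinite I).cast_ncard_eq] at this
    exact_mod_cast this.symm
  have hcl : N.closure I = F := by
    rw [← closure_eq_of_indep_iff hE h hI.indep (hIk ▸ hk), hI.closure_eq_closure, hF.closure]
  refine ⟨hcl ▸ N.isFlat_closure I, ?_⟩
  rw [← hcl, N.eRk_closure_eq, ((h I (by omega)).1 hI.indep).eRk_eq_encard,
    ← (Set.toFinite I).cast_ncard_eq, hIk]

theorem samePointsAndLines_of_indep_iff [Finite ι] {r : ℕ} (hE : M.E = N.E)
    (h : ∀ I : Set ι, I.ncard ≤ r → (M.Indep I ↔ N.Indep I)) (hr : 3 ≤ r) :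
    M.SamePointsAndLines N :=
  have h' : ∀ I : Set ι, I.ncard ≤ r → (N.Indep I ↔ M.Indep I) := fun I hI => (h I hI).symm
  ⟨fun _ => ⟨fun hF => hF.of_indep_iff hE h (k := 1) (by omega),
      fun hF => hF.of_indep_iff hE.symm h' (k := 1) (by omega)⟩,
    fun _ => ⟨fun hF => hF.of_indep_iff hE h (k := 2) (by omega),
      fun hF => hF.of_indep_iff hE.symm h' (k := 2) (by omega)⟩⟩

/-- A rank three matroid with a nontrivial erection is not taut. -/
theorem not_isTaut_of_planes [Finite ι] (M : Matroid ι) (planes : Set (Set ι)) (hE : M.E = univ)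
    (rank_le : ∀ I, M.Indep I → I.ncard ≤ 3)
    (unique : ∀ B P P', M.Indep B → B.ncard = 3 → P ∈ planes → P' ∈ planes → B ⊆ P → B ⊆ P' →
      P = P')
    (closed : ∀ B e, M.Indep B → B.ncard = 3 → e ∉ B →
      (∃ J ⊆ insert e B, J.ncard = 3 ∧ ¬ M.Indep J) → ∃ P ∈ planes, insert e B ⊆ P)
    (exists_spanning : ∃ I : Set ι, I.ncard = 4 ∧ (∀ J ⊆ I, J.ncard = 3 → M.Indep J) ∧
      ∀ P ∈ planes, ¬ I ⊆ P) : ¬ M.IsTaut := by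
  let N := M.erection planes rank_le unique closed
  have hind : ∀ I, N.Indep I ↔ M.Indep I ∨
      I.ncard = 4 ∧ (∀ J ⊆ I, J.ncard = 3 → M.Indep J) ∧ ∀ P ∈ planes, ¬ I ⊆ P := fun I => Iff.rfl
  have hEN : M.E = N.E := hE
  have h : ∀ I : Set ι, I.ncard ≤ 3 → (M.Indep I ↔ N.Indep I) := fun I hI => by
    rw [hind, or_iff_left]
    omega
  obtain ⟨I, hI⟩ := exists_spanning
  obtain ⟨B, hB⟩ := M.exists_isBase
  refine fun ht => ht ⟨N, isQuotientOf_of_indep_iff hEN h rank_le,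
    samePointsAndLines_of_indep_iff hEN h le_rfl, ?_⟩
  calc M.eRank = B.encard := hB.encard_eq_eRank.symm
    _ ≤ (3 : ℕ) := by
      rw [← (Set.toFinite B).cast_ncard_eq]
      exact_mod_cast rank_le B hB.indep
    _ < (4 : ℕ) := by norm_num
    _ = I.encard := by rw [← (Set.toFinite I).cast_ncard_eq, hI.1]
    _ ≤ N.eRank := ((hind I).2 (Or.inr hI)).encard_le_eRank

end Matroid

/-! ### Vector families and arrangements. -/

theorem linearIndepOn_triple_iff_det_ne_zero {ι K : Type*} [Field K] (v : ι → Fin 3 → K)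
    {i j k : ι} (hij : i ≠ j) (hik : i ≠ k) (hjk : j ≠ k) :
    LinearIndepOn K v {i, j, k} ↔ (Matrix.of ![v i, v j, v k]).det ≠ 0 := by
  have hinj : Function.Injective ![i, j, k] := by
    intro a b
    fin_cases a <;> fin_cases b <;> simp [hij, hik, hjk, hij.symm, hik.symm, hjk.symm]
  have hrange : ({i, j, k} : Set ι) = range ![i, j, k] := by
    ext x
    simp [eq_comm]
    tauto
  rw [hrange, linearIndepOn_range_iff hinj, ← isUnit_iff_ne_zero,
    ← Matrix.isUnit_iff_isUnit_det, ← Matrix.linearIndependent_rows_iff_isUnit]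
  have : v ∘ ![i, j, k] = (Matrix.of ![v i, v j, v k]).row := by
    funext a
    fin_cases a <;> rfl
  rw [this]

theorem LinearIndepOn.ncard_le_finrank {ι K W : Type*} [Finite ι] [Field K] [AddCommGroup W]
    [Module K W] [FiniteDimensional K W] {v : ι → W} {I : Set ι} (hI : LinearIndepOn K v I) :
    I.ncard ≤ finrank K W := by
  have := Fintype.ofFinite I
  have h := hI.linearIndependent.fintype_card_le_finrank
  rwa [← Nat.card_eq_fintype_card, Nat.card_coe_set_eq] at h

/-- Linear forms whose linear matroid is simple define an arrangement with that matroid. -/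
theorem exists_arrangement_matroid_eq {ι K : Type*} [Finite ι] [Field K] {ℓ : ℕ}
    (v : ι → Fin ℓ → K) (hv : (linearMatroid K v).IsSimple) :
    ∃ A : Arrangement K ℓ ι, A.matroid = linearMatroid K v := by
  let α : ι → Dual K (Fin ℓ → K) := fun i => dotProductEquiv K (Fin ℓ) (v i)
  have hmat : linearMatroid K α = linearMatroid K v := by
    refine Matroid.ext_indep rfl fun I _ => ?_
    exact (dotProductEquiv K (Fin ℓ)).toLinearMap.linearIndepOn_iff_of_injOn
      (dotProductEquiv K (Fin ℓ)).injective.injOn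
  have hne : ∀ i, α i ≠ 0 := by
    intro i h
    refine hv.1 i (mem_univ i) ?_
    rw [← Matroid.singleton_dep, ← hmat, Matroid.dep_iff]
    refine ⟨fun hi => ?_, by simp⟩
    exact LinearIndepOn.ne_zero (R := K) (v := α) hi (mem_singleton i) h
  let A : Arrangement K ℓ ι :=
    { hyperplane := fun i => LinearMap.ker (α i)
      codim_eq_one := fun i => by
        rw [(LinearMap.quotKerEquivOfSurjective (α i)
          (LinearMap.surjective (hne i))).finrank_eq, finrank_self]
      injective := by
        intro i j hij
        by_contra hne'
        have hind := hv.2 i (mem_univ i) j (mem_univ j) hne'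
        rw [← hmat, linearMatroid_indep, LinearIndepOn.pair_iff _ hne'] at hind
        have hmem : α j ∈ Submodule.span K (range fun _ : Unit => α i) :=
          mem_span_of_iInf_ker_le_ker (by simpa using hij.le)
        obtain ⟨c, hc⟩ := Submodule.mem_span_singleton.1 (by simpa using hmem)
        have := (hind c (-1) (by rw [hc]; simp)).2
        simp at this }
  exact ⟨A, (A.matroid_eq (α := α) fun _ => rfl).trans hmat⟩

/-! ### The configuration: rank three, simple, not taut. -/

/-- The Pappus configuration without one of its points, together with five further points `8`, …,
`12`: the lines through `8`, and those through `9`, join `10`, `11` and `12` to the points on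
the three lines through the missing point. -/
def punctured : Fin 13 → Fin 3 → ℤ :=
  ![![1, 0, 0], ![0, 1, 0], ![0, 0, 1], ![1, 1, 0], ![1, 0, 1], ![3, -2, 3], ![3, -2, 2],
    ![2, -1, 1], ![3, -3, -2], ![1, -2, -2], ![3, -4, -2], ![3, -3, -4], ![5, -4, -1]]

namespace punctured

/-- The lines with more than two points, each encoded by its indicator function, read as a binary
number. -/
def lines : List ℕ := [11, 21, 50, 100, 193, 1282, 1600, 2308, 2568, 4480, 4624]

/-- The planes with more than three points of a matroid of rank four with these lines, encoded in
the same way. It is not representable: the planes through `8`, `9` and one of `10`, `11`, `12` would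
meet the plane of `0`, …, `7` in concurrent lines, and `3`, `5`, `7` would be collinear by Pappus'
theorem. -/
def planes : List ℕ :=
  [255, 1291, 2571, 2325, 4629, 4545, 1729, 3334, 1330, 4658, 1858, 5506, 2828, 2404, 1636, 6532,
    6680, 3656, 5712, 5008, 4107, 1045, 2241, 2098, 4196, 2600, 4488, 2696, 4512]

def contains (i j k : Fin 13) (m : ℕ) : Bool := m.testBit i && m.testBit j && m.testBit k

def collinear (i j k : Fin 13) : Bool := lines.any (contains i j k)

def det (i j k : Fin 13) : ℤ :=
  punctured i 0 * (punctured j 1 * punctured k 2 - punctured j 2 * punctured k 1) -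
    punctured i 1 * (punctured j 0 * punctured k 2 - punctured j 2 * punctured k 0) +
    punctured i 2 * (punctured j 0 * punctured k 1 - punctured j 1 * punctured k 0)

theorem det_eq_zero_iff :
    ∀ i j, i < j → ∀ k, j < k → (det i j k = 0 ↔ collinear i j k = true) := by
  decide +kernel

/-- Hypothesis `unique` of `erection` as a finite check. -/
theorem plane_unique : ∀ i j, i < j → ∀ k, j < k → collinear i j k = false →
    (planes.filter (contains i j k)).length ≤ 1 := by
  decide +kernel

/-- Source of hypothesis `closed` of `erection`: a dependent triple is a listed line, and it spans a
listed plane with any fourth point `u`. -/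
theorem exists_plane : ∀ i j, i < j → ∀ k, j < k → collinear i j k = true →
    ∀ u : Fin 13, ∃ m ∈ planes, contains i j k m ∧ m.testBit u := by
  decide +kernel

theorem exists_lt_of_ncard {α : Type*} [LinearOrder α] {T : Set α} (hT : T.ncard = 3) :
    ∃ i j k, i < j ∧ j < k ∧ T = {i, j, k} := by
  obtain ⟨i, j, k, hij, hik, hjk, rfl⟩ := Set.ncard_eq_three.1 hT
  rcases hij.lt_or_gt with h1 | h1 <;> rcases hik.lt_or_gt with h2 | h2 <;>
    rcases hjk.lt_or_gt with h3 | h3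
  · exact ⟨i, j, k, h1, h3, rfl⟩
  · exact ⟨i, k, j, h2, h3, by rw [Set.pair_comm]⟩
  · exact absurd (h1.trans h3) h2.not_gt
  · exact ⟨k, i, j, h2, h1, by rw [Set.insert_comm k i, Set.pair_comm k j]⟩
  · exact ⟨j, i, k, h1, h2, by rw [Set.insert_comm]⟩
  · exact absurd (h3.trans h1) h2.not_gt
  · exact ⟨j, k, i, h3, h2, by rw [Set.insert_comm i j, Set.pair_comm i k]⟩
  · exact ⟨k, j, i, h3, h1, by
      rw [Set.insert_comm i j, Set.pair_comm i k, Set.insert_comm j k, Set.pair_comm j i]⟩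

def matroid : Matroid (Fin 13) := linearMatroid ℚ fun i j => (punctured i j : ℚ)

theorem indep_iff {i j k : Fin 13} (hij : i < j) (hjk : j < k) :
    matroid.Indep {i, j, k} ↔ collinear i j k = false := by
  rw [← Bool.not_eq_true, ← det_eq_zero_iff i j hij k hjk, matroid, linearMatroid_indep,
    linearIndepOn_triple_iff_det_ne_zero _ hij.ne (hij.trans hjk).ne hjk.ne, not_iff_not,
    ← Int.cast_eq_zero (α := ℚ)]
  have : (Matrix.of ![fun l => (punctured i l : ℚ), fun l => (punctured j l : ℚ),
      fun l => (punctured k l : ℚ)]).det = (det i j k : ℤ) := by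
    rw [Matrix.det_fin_three, det]
    simp
    ring
  rw [this]

theorem ncard_le {I : Set (Fin 13)} (hI : matroid.Indep I) : I.ncard ≤ 3 := by
  have h : LinearIndepOn ℚ (fun i j => (punctured i j : ℚ)) I := hI
  simpa using h.ncard_le_finrank

theorem indep_pair {i j : Fin 13} (hij : i ≠ j) : matroid.Indep {i, j} := by
  -- A third point off the line of `i` and `j`; the three cases are its possible positions in the
  -- order, as `indep_iff` wants increasing triples.
  have h : ∀ i j : Fin 13, i < j → (∃ k, j < k ∧ collinear i j k = false) ∨
      (∃ k, i < k ∧ k < j ∧ collinear i k j = false) ∨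
      ∃ k, k < i ∧ collinear k i j = false := by
    decide +kernel
  wlog hlt : i < j generalizing i j
  · rw [Set.pair_comm]
    exact this hij.symm (hij.lt_or_gt.resolve_left hlt)
  rcases h i j hlt with ⟨k, hk, hc⟩ | ⟨k, hik, hkj, hc⟩ | ⟨k, hk, hc⟩
  · refine ((indep_iff hlt hk).2 hc).subset ?_
    rw [Set.pair_comm j k, Set.insert_comm i k]
    exact Set.subset_insert _ _
  · refine ((indep_iff hik hkj).2 hc).subset ?_
    rw [Set.insert_comm i k]
    exact Set.subset_insert _ _
  · exact ((indep_iff hk hlt).2 hc).subset (Set.subset_insert _ _)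

theorem isSimple : matroid.IsSimple := by
  refine ⟨fun e _ he => ?_, fun e _ f _ hef => indep_pair hef⟩
  obtain ⟨f, hf⟩ := exists_ne e
  exact he.not_indep_of_mem (mem_insert e {f}) (indep_pair hf.symm)

theorem eRank_eq : matroid.eRank = 3 := by
  obtain ⟨B, hB⟩ := matroid.exists_isBase
  have h3 : matroid.Indep {0, 1, 2} := (indep_iff (by decide) (by decide)).2 (by decide +kernel)
  refine le_antisymm ?_ ?_
  · rw [← hB.encard_eq_eRank, ← (Set.toFinite B).cast_ncard_eq]
    exact_mod_cast ncard_le hB.indep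
  · have := h3.encard_le_eRank
    rwa [Set.encard_eq_three.2 ⟨0, 1, 2, by decide, by decide, by decide, rfl⟩] at this

theorem not_isTaut : ¬ matroid.IsTaut := by
  have hmem : ∀ i j k m, contains i j k m = true ↔
      ({i, j, k} : Set (Fin 13)) ⊆ {x | m.testBit x = true} := by
    intro i j k m
    simp [contains, Set.insert_subset_iff, and_assoc]
  -- `{0, 1, 2, 8}` is a basis of the erection: `0`, `1`, `2` span the plane of `0`–`7`, and `8`
  -- lies off it.
  refine matroid.not_isTaut_of_planes {P | ∃ m ∈ planes, {x : Fin 13 | m.testBit x = true} = P} rfl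
    (fun _ => ncard_le) ?_ ?_ ⟨{0, 1, 2, 8}, ?_, ?_, ?_⟩
  · rintro B _ _ hB hB3 ⟨m, hm, rfl⟩ ⟨m', hm', rfl⟩ hBm hBm'
    obtain ⟨i, j, k, hij, hjk, rfl⟩ := exists_lt_of_ncard hB3
    have hle := plane_unique i j hij k hjk ((indep_iff hij hjk).1 hB)
    have h := List.mem_filter.2 ⟨hm, (hmem i j k m).2 hBm⟩
    have h' := List.mem_filter.2 ⟨hm', (hmem i j k m').2 hBm'⟩
    obtain ⟨a, ha⟩ := List.length_eq_one_iff.1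
      (hle.antisymm (List.length_pos_of_mem h))
    rw [ha, List.mem_singleton] at h h'
    rw [h, h']
  · rintro B e hB hB3 heB ⟨J, hJ, hJ3, hJn⟩
    have hc : (insert e B).ncard = 4 := by
      rw [Set.ncard_insert_of_notMem heB (Set.toFinite B), hB3]
    -- The collinear triple `J` need not contain `e`; the four points are regrouped as `J` and one
    -- further point `u`.
    obtain ⟨u, hu, huJ⟩ := Set.exists_mem_notMem_of_ncard_lt_ncard (s := J) (t := insert e B)
      (by omega) (Set.toFinite J)
    have hins : insert u J = insert e B := by
      refine Set.eq_of_subset_of_ncard_le (Set.insert_subset hu hJ) ?_ (Set.toFinite _)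
      rw [Set.ncard_insert_of_notMem huJ (Set.toFinite J)]
      omega
    obtain ⟨i, j, k, hij, hjk, rfl⟩ := exists_lt_of_ncard hJ3
    rw [indep_iff hij hjk, Bool.not_eq_false] at hJn
    obtain ⟨m, hm, hmJ, hmu⟩ := exists_plane i j hij k hjk hJn u
    exact ⟨_, ⟨m, hm, rfl⟩, hins ▸ Set.insert_subset hmu ((hmem i j k m).1 hmJ)⟩
  · rw [Set.ncard_insert_of_notMem (by simp), Set.ncard_eq_three.2
      ⟨1, 2, 8, by decide, by decide, by decide, rfl⟩]
  · intro J hJ hJ3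
    obtain ⟨i, j, k, hij, hjk, rfl⟩ := exists_lt_of_ncard hJ3
    have h : ∀ i j : Fin 13, i < j → ∀ k, j < k → collinear i j k = true →
        ¬ ((i = 0 ∨ i = 1 ∨ i = 2 ∨ i = 8) ∧ (j = 0 ∨ j = 1 ∨ j = 2 ∨ j = 8) ∧
          (k = 0 ∨ k = 1 ∨ k = 2 ∨ k = 8)) := by
      decide +kernel
    rw [indep_iff hij hjk, ← Bool.not_eq_true]
    intro hc
    exact h i j hij k hjk hc (by simpa [Set.insert_subset_iff] using hJ)
  · rintro _ ⟨m, hm, rfl⟩ h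
    have hn : ∀ m ∈ planes, ¬ (m.testBit (0 : Fin 13) ∧ m.testBit (1 : Fin 13) ∧
        m.testBit (2 : Fin 13) ∧ m.testBit (8 : Fin 13)) := by
      decide +kernel
    exact hn m hm ⟨h (by simp), h (by simp), h (by simp), h (by simp)⟩

end punctured

/-! ### Three-term relations and Pappus' theorem. -/

section LinearRelations

variable {ι K W W' : Type*} [Field K] [AddCommGroup W] [Module K W] [AddCommGroup W'] [Module K W']

theorem exists_eq_smul_add_smul {v : ι → W} {i j k : ι} (hik : i ≠ k) (hjk : j ≠ k)
    (h₁ : LinearIndepOn K v {i, j}) (h₂ : LinearIndepOn K v {i, k})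
    (h₃ : LinearIndepOn K v {j, k}) (h : ¬ LinearIndepOn K v {i, j, k}) :
    ∃ p q : K, p ≠ 0 ∧ q ≠ 0 ∧ v k = p • v i + q • v j := by
  have hmem : v k ∈ Submodule.span K (v '' {i, j}) := by
    by_contra hn
    have hins := h₁.insert hn
    rw [Set.insert_comm, Set.pair_comm k j] at hins
    exact h hins
  rw [Set.image_pair, Submodule.mem_span_pair] at hmem
  obtain ⟨p, q, hpq⟩ := hmem
  rw [LinearIndepOn.pair_iff _ hik] at h₂
  rw [LinearIndepOn.pair_iff _ hjk] at h₃
  refine ⟨p, q, ?_, ?_, hpq.symm⟩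
  · rintro rfl
    have := (h₃ q (-1) (by rw [← hpq]; module)).2
    simp at this
  · rintro rfl
    have := (h₂ p (-1) (by rw [← hpq]; module)).2
    simp at this

/-- Pappus' theorem: if the points `t`, `A₂`, `B₂` are not collinear, then the lines `A₀B₀`,
`A₁B₂` and `A₂B₁` have no common point. -/
theorem eq_zero_of_pappus {s A₀ A₁ B₂ B₁ t B₀ A₂ w : W} {p q r u e f g h i j a b c d k l : K}
    (hB₂ : B₂ = p • s + q • A₀) (hB₁ : B₁ = r • s + u • A₁) (ht : t = e • A₀ + f • B₁)
    (hB₀ : B₀ = g • A₁ + h • t) (hA₂ : A₂ = i • s + j • B₀)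
    (hq : q ≠ 0) (hr : r ≠ 0) (hu : u ≠ 0) (hf : f ≠ 0) (hh : h ≠ 0)
    (hind : ∀ x y z : K, x • s + y • A₀ + z • A₁ = 0 → x = 0 ∧ y = 0 ∧ z = 0)
    (hind' : ∀ x y z : K, x • B₂ + y • t + z • A₂ = 0 → x = 0 ∧ y = 0 ∧ z = 0)
    (h₀ : w = a • A₀ + b • B₀) (h₁ : w = c • A₁ + d • B₂) (h₂ : w = k • A₂ + l • B₁) :
    w = 0 := by
  subst hB₂ hB₁ ht hB₀ hA₂
  -- Coordinates with respect to `s`, `A₀`, `A₁` of the equality of two expressions for `w`.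
  obtain ⟨e₁, e₂, e₃⟩ := hind (b * h * f * r - d * p) (a + b * h * e - d * q)
    (b * (g + h * f * u) - c) (by linear_combination (norm := module) h₁ - h₀)
  obtain ⟨e₄, e₅, e₆⟩ := hind (k * (i + j * h * f * r) + l * r - d * p) (k * j * h * e - d * q)
    (k * j * (g + h * f * u) + l * u - c) (by linear_combination (norm := module) h₁ - h₂)
  have h₃ : q * b * f * r - p * k * j * e = 0 := by
    refine (mul_eq_zero.1 (?_ : h * _ = 0)).resolve_left hh
    linear_combination q * e₁ - p * e₅
  have h₄ : k * i * u + (b - k * j) * r * g = 0 := by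
    linear_combination u * e₄ - u * e₁ - r * e₆ + r * e₃
  -- The second factor is the determinant of `B₂`, `t`, `A₂` in these coordinates.
  have hdet : k * (i * q * f * u + j * g * (p * e - q * f * r)) = 0 := by
    linear_combination q * f * h₄ - g * h₃
  have hk : k = 0 := by
    refine (mul_eq_zero.1 hdet).resolve_right fun h0 => ?_
    -- The coefficients are the cofactors along the `s`-column, so the combination is the
    -- determinant times `s`; the last one, `f * u * q`, is nonzero.
    refine mul_ne_zero (mul_ne_zero hf hu) hq
      (hind' (j * g * e) (-(f * u * q * j * h + j * g * q)) (f * u * q) ?_).2.2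
    have := congrArg (fun c => c • s) h0
    simp only [zero_smul] at this
    linear_combination (norm := module) this
  subst hk
  have hd : d = 0 := (mul_eq_zero.1 (by linear_combination -e₅ : d * q = 0)).resolve_right hq
  subst hd
  have hl : l = 0 := (mul_eq_zero.1 (by linear_combination e₄ : l * r = 0)).resolve_right hr
  rw [h₂, hl]
  simp

/-- Of the combinations `x • a - y • b`, two that are not proportional span both `a` and `b`. -/
theorem mem_of_smul_sub_smul_mem {U : Submodule K W} {a b : W} {x y x' y' : K} (hx : x ≠ 0)
    (h : x • a - y • b ∈ U) (h' : x' • a - y' • b ∈ U) (hne : y * x' ≠ x * y') :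
    a ∈ U ∧ b ∈ U := by
  have hb : b ∈ U := by
    rw [← U.smul_mem_iff (sub_ne_zero.2 hne)]
    have := U.sub_mem (U.smul_mem x h') (U.smul_mem x' h)
    convert this using 1
    module
  refine ⟨?_, hb⟩
  rw [← U.smul_mem_iff hx]
  convert U.add_mem h (U.smul_mem y hb) using 1
  module

end LinearRelations

/-! ### Formality of every realization. -/

namespace punctured

variable {K W W' : Type*} [Field K] [AddCommGroup W] [Module K W] [AddCommGroup W'] [Module K W']
  {v : Fin 13 → W}

/-- The triple `x < y < z` sorts `i`, `j`, `k`, leaving free which point the relation is solved for.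
-/
theorem exists_eq_smul_add_smul_of_collinear (hv : linearMatroid K v = matroid) {i j k : Fin 13}
    (x y z : Fin 13) (hxy : x < y) (hyz : y < z) (hc : collinear x y z = true)
    (hset : ({i, j, k} : Finset (Fin 13)) = {x, y, z}) (hik : i ≠ k) (hjk : j ≠ k) (hij : i ≠ j) :
    ∃ p q : K, p ≠ 0 ∧ q ≠ 0 ∧ v k = p • v i + q • v j := by
  have hpair : ∀ {i j : Fin 13}, i ≠ j → LinearIndepOn K v {i, j} := fun h => by
    rw [← linearMatroid_indep, hv]
    exact indep_pair h
  refine exists_eq_smul_add_smul hik hjk (hpair hij) (hpair hik) (hpair hjk) fun h => ?_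
  have hset' : ({i, j, k} : Set (Fin 13)) = {x, y, z} := by
    simpa only [Finset.coe_insert, Finset.coe_singleton] using
      congrArg (fun T : Finset (Fin 13) => (T : Set (Fin 13))) hset
  rw [hset', ← linearMatroid_indep, hv, indep_iff hxy hyz, hc] at h
  exact Bool.noConfusion h

theorem eq_zero_of_not_collinear (hv : linearMatroid K v = matroid) {i j k : Fin 13}
    (hij : i < j) (hjk : j < k) (hc : collinear i j k = false) (x y z : K)
    (h : x • v i + y • v j + z • v k = 0) : x = 0 ∧ y = 0 ∧ z = 0 := by
  have hind : LinearIndepOn K v {i, j, k} := by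
    rw [← linearMatroid_indep, hv]
    exact (indep_iff hij hjk).2 hc
  have hk : v k ∉ Submodule.span K (v '' {i, j}) := by
    have hnot : k ∉ ({i, j} : Set (Fin 13)) := by simp [hjk.ne', (hij.trans hjk).ne']
    refine (linearIndepOn_insert hnot).1 ?_ |>.2
    convert hind using 1
    rw [Set.insert_comm, Set.pair_comm k j]
  have hz : z = 0 := by
    by_contra hz
    refine hk ?_
    rw [Set.image_pair, Submodule.mem_span_pair]
    refine ⟨-(z⁻¹ * x), -(z⁻¹ * y), ?_⟩
    have h1 : (z⁻¹ * z) • v k = v k := by rw [inv_mul_cancel₀ hz, one_smul]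
    linear_combination (norm := module) (-z⁻¹) • h + h1
  subst hz
  have hpair := (LinearIndepOn.pair_iff (R := K) v hij.ne).1
    (hind.mono (by simp [Set.insert_subset_iff]))
  obtain ⟨hx, hy⟩ := hpair x y (by simpa using h)
  exact ⟨hx, hy, rfl⟩

theorem mem_span_of_linear_relations (hv : linearMatroid K v = matroid) (f : Fin 13 → W')
    (hf : ∀ i j k (p q : K), v k = p • v i + q • v j → f k = p • f i + q • f j) (i : Fin 13) :
    f i ∈ Submodule.span K {f 0, f 1, f 2} := by
  set U := Submodule.span K {f 0, f 1, f 2} with hU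
  have mem : ∀ {i j k : Fin 13} {p q : K}, v k = p • v i + q • v j → f i ∈ U → f j ∈ U → f k ∈ U :=
    fun h hi hj => hf _ _ _ _ _ h ▸ U.add_mem (U.smul_mem _ hi) (U.smul_mem _ hj)
  have m0 : f 0 ∈ U := Submodule.subset_span (by simp)
  have m1 : f 1 ∈ U := Submodule.subset_span (by simp)
  have m2 : f 2 ∈ U := Submodule.subset_span (by simp)
  have rel := fun {i j k} => exists_eq_smul_add_smul_of_collinear (i := i) (j := j) (k := k) hv
  obtain ⟨p₃, q₃, hp₃, hq₃, h₃⟩ := rel (i := 0) (j := 1) (k := 3) 0 1 3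
    (by decide) (by decide) (by decide +kernel) (by decide) (by decide) (by decide) (by decide)
  obtain ⟨p₄, q₄, hp₄, hq₄, h₄⟩ := rel (i := 0) (j := 2) (k := 4) 0 2 4
    (by decide) (by decide) (by decide +kernel) (by decide) (by decide) (by decide) (by decide)
  obtain ⟨p₅, q₅, hp₅, hq₅, h₅⟩ := rel (i := 1) (j := 4) (k := 5) 1 4 5
    (by decide) (by decide) (by decide +kernel) (by decide) (by decide) (by decide) (by decide)
  obtain ⟨p₆, q₆, hp₆, hq₆, h₆⟩ := rel (i := 2) (j := 5) (k := 6) 2 5 6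
    (by decide) (by decide) (by decide +kernel) (by decide) (by decide) (by decide) (by decide)
  obtain ⟨p₇, q₇, hp₇, hq₇, h₇⟩ := rel (i := 0) (j := 6) (k := 7) 0 6 7
    (by decide) (by decide) (by decide +kernel) (by decide) (by decide) (by decide) (by decide)
  obtain ⟨x, x', hx, -, hx₁⟩ := rel (i := 8) (j := 1) (k := 10) 1 8 10
    (by decide) (by decide) (by decide +kernel) (by decide) (by decide) (by decide) (by decide)
  obtain ⟨r, r', -, -, hx₂⟩ := rel (i := 9) (j := 6) (k := 10) 6 9 10
    (by decide) (by decide) (by decide +kernel) (by decide) (by decide) (by decide) (by decide)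
  obtain ⟨y, y', hy, -, hy₁⟩ := rel (i := 8) (j := 2) (k := 11) 2 8 11
    (by decide) (by decide) (by decide +kernel) (by decide) (by decide) (by decide) (by decide)
  obtain ⟨s, s', -, -, hy₂⟩ := rel (i := 9) (j := 3) (k := 11) 3 9 11
    (by decide) (by decide) (by decide +kernel) (by decide) (by decide) (by decide) (by decide)
  obtain ⟨z, z', hz, -, hz₁⟩ := rel (i := 8) (j := 7) (k := 12) 7 8 12
    (by decide) (by decide) (by decide +kernel) (by decide) (by decide) (by decide) (by decide)
  obtain ⟨t, t', -, -, hz₂⟩ := rel (i := 9) (j := 4) (k := 12) 4 9 12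
    (by decide) (by decide) (by decide +kernel) (by decide) (by decide) (by decide) (by decide)
  have m3 := mem h₃ m0 m1
  have m4 := mem h₄ m0 m2
  have m5 := mem h₅ m1 m4
  have m6 := mem h₆ m2 m5
  have m7 := mem h₇ m0 m6
  have ex : x • f 8 - r • f 9 ∈ U := by
    have : x • f 8 - r • f 9 = r' • f 6 - x' • f 1 := by
      linear_combination (norm := module) hf _ _ _ _ _ hx₂ - hf _ _ _ _ _ hx₁
    exact this ▸ U.sub_mem (U.smul_mem _ m6) (U.smul_mem _ m1)
  have ey : y • f 8 - s • f 9 ∈ U := by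
    have : y • f 8 - s • f 9 = s' • f 3 - y' • f 2 := by
      linear_combination (norm := module) hf _ _ _ _ _ hy₂ - hf _ _ _ _ _ hy₁
    exact this ▸ U.sub_mem (U.smul_mem _ m3) (U.smul_mem _ m2)
  have ez : z • f 8 - t • f 9 ∈ U := by
    have : z • f 8 - t • f 9 = t' • f 4 - z' • f 7 := by
      linear_combination (norm := module) hf _ _ _ _ _ hz₂ - hf _ _ _ _ _ hz₁
    exact this ▸ U.sub_mem (U.smul_mem _ m4) (U.smul_mem _ m7)
  have m89 : f 8 ∈ U ∧ f 9 ∈ U := by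
    by_cases hxy : r * y = x * s
    · by_cases hxz : r * z = x * t
      · exfalso
        -- Proportionality gives `(y z)(x v₈ - r v₉) = (x z)(y v₈ - s v₉) = (x y)(z v₈ - t v₉)`;
        -- eliminating `v 10`, `v 11`, `v 12` places this vector on the lines `1 6`, `2 3`, `7 4`.
        have hw := eq_zero_of_pappus (w := (y * z) • (x • v 8 - r • v 9))
          (a := -(y * z * x')) (b := y * z * r') (c := -(x * z * y')) (d := x * z * s')
          (k := -(x * y * z')) (l := x * y * t') h₃ h₄ h₅ h₆ h₇ hq₃ hp₄ hq₄ hq₅ hq₆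
          (eq_zero_of_not_collinear hv (by decide) (by decide) (by decide +kernel))
          (eq_zero_of_not_collinear hv (by decide) (by decide) (by decide +kernel)) ?_ ?_ ?_
        · have hind : LinearIndepOn K v {8, 9} := by
            rw [← linearMatroid_indep, hv]
            exact indep_pair (by decide)
          rw [LinearIndepOn.pair_iff _ (by decide)] at hind
          refine mul_ne_zero (mul_ne_zero hy hz) hx
            (hind (y * z * x) (-(y * z * r)) ?_).1
          rw [← hw]
          module
        · linear_combination (norm := module) (y * z) • (hx₂ - hx₁)
        · have := congrArg (fun c => (z * c) • v 9) hxy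
          linear_combination (norm := module) (x * z) • (hy₂ - hy₁) - this
        · have := congrArg (fun c => (y * c) • v 9) hxz
          linear_combination (norm := module) (x * y) • (hz₂ - hz₁) - this
      · exact mem_of_smul_sub_smul_mem hx ex ez hxz
    · exact mem_of_smul_sub_smul_mem hx ex ey hxy
  obtain ⟨m8, m9⟩ := m89
  have m10 := mem hx₁ m8 m1
  have m11 := mem hy₁ m8 m2
  have m12 := mem hz₁ m8 m7
  fin_cases i <;> assumption

theorem isFormal {ℓ : ℕ} (A : Arrangement K ℓ (Fin 13)) (hA : A.matroid = matroid) :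
    A.IsFormal := by
  intro α hα
  have hv : linearMatroid K α = matroid := (A.matroid_eq hα).symm.trans hA
  set S := Submodule.span K {y : Fin 13 →₀ K |
    y ∈ LinearMap.ker (Finsupp.linearCombination K α) ∧ y.support.card ≤ 3} with hS
  have hle : S ≤ LinearMap.ker (Finsupp.linearCombination K α) :=
    Submodule.span_le.2 fun y hy => hy.1
  refine hle.antisymm fun y hy => ?_
  -- Modulo `S` the unit vectors obey every three-term relation by construction, so three of them
  -- span the quotient.
  let f : Fin 13 → (Fin 13 →₀ K) ⧸ S := fun i => S.mkQ (Finsupp.single i 1)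
  have hf : ∀ i j k (p q : K), α k = p • α i + q • α j → f k = p • f i + q • f j := by
    intro i j k p q h
    rw [← sub_eq_zero]
    simp only [f, ← map_smul, ← map_add, ← map_sub]
    rw [Submodule.mkQ_apply, Submodule.Quotient.mk_eq_zero]
    refine Submodule.subset_span ⟨?_, ?_⟩
    · simp [LinearMap.mem_ker, h]
    · refine (Finset.card_le_card (t := {k, i, j}) fun x hx => ?_).trans Finset.card_le_three
      by_contra hn
      simp only [Finset.mem_insert, Finset.mem_singleton, not_or] at hn
      simp [Ne.symm hn.1, Ne.symm hn.2.1, Ne.symm hn.2.2] at hx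
  have hmem : S.mkQ y ∈ Submodule.span K {f 0, f 1, f 2} := by
    rw [← Finsupp.sum_single y, Finsupp.sum, map_sum]
    refine Submodule.sum_mem _ fun i _ => ?_
    have : Finsupp.single i (y i) = y i • Finsupp.single i (1 : K) := by simp
    rw [this, map_smul]
    exact Submodule.smul_mem _ _ (mem_span_of_linear_relations hv f hf i)
  obtain ⟨a, b, c, h⟩ := Submodule.mem_span_triple.1 hmem
  have hsub : y - (a • Finsupp.single 0 1 + b • Finsupp.single 1 1 + c • Finsupp.single 2 1) ∈ S := by
    rw [← Submodule.Quotient.mk_eq_zero, ← Submodule.mkQ_apply, map_sub, ← h, map_add, map_add,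
      map_smul, map_smul, map_smul, sub_self]
  -- Applying the forms leaves a relation among the independent `α 0`, `α 1`, `α 2`, so its
  -- coefficients vanish.
  have hker := hle hsub
  rw [LinearMap.mem_ker, map_sub, LinearMap.mem_ker.1 hy, zero_sub, neg_eq_zero] at hker
  obtain ⟨rfl, rfl, rfl⟩ := eq_zero_of_not_collinear hv (i := 0) (j := 1) (k := 2) (by decide)
    (by decide) (by decide +kernel) a b c (by simpa using hker)
  simpa using hsub

end punctured

theorem theorem1p1 :
    ∃ M : Matroid (Fin 13),
      M.E = Set.univ ∧ M.eRank = 3 ∧ M.IsSimple ∧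
      (∃ A : Arrangement ℚ 3 (Fin 13), A.matroid = M) ∧
      ¬ M.IsTaut ∧
      ∀ (K : Type*) [Field K] (ℓ : ℕ) (A : Arrangement K ℓ (Fin 13)),
        A.matroid = M → A.IsFormal :=
  ⟨punctured.matroid, rfl, punctured.eRank_eq, punctured.isSimple,
    exists_arrangement_matroid_eq _ punctured.isSimple, punctured.not_isTaut,
    fun _ _ _ A hA => punctured.isFormal A hA⟩
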